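/- Consider $N$ arms. Arm $n$ is a Markov decision process with finite nonempty state set $\mathcal S_n$, finite action set $\mathcal A_n$, transition probabilities $T_n(s,a,\cdot)$, reward $R_n(s)$ and action costs $\mathcal C_n:\mathcal A_n\to\mathbb R$, where some passive action has cost $0$. Let $\beta\in[0,1)$ be the common discount factor and $B\ge 0$ the budget per round, with $B\le\sum_{n}\max_{a}\mathcal C_n(a)$. For $\lambda\in\mathbb R$ let $Q_n(\cdot,\cdot,\lambda)$ be the optimal $Q$-function of arm $n$, i.e. the solution of $$Q_n(s,a,\lambda)=R_n(s)-\lambda\,\mathcal C_n(a)+\beta\sum_{s'}T_n(s,a,s')\max_{a'}Q_n(s',a',\lambda),$$ and for a joint state $\boldsymbol s=(s_1,\dots,s_N)$ let $$J(\boldsymbol s,\lambda)=\frac{\lambda B}{1-\beta}+\sum_{n=1}^N\max_{a}Q_n(s_n,a,\lambda),\qquad \Lambda^\star(\boldsymbol s)=\operatorname*{arg\,min}_{\lambda\in\mathbb R}J(\boldsymbol s,\lambda).$$ A table $\Lambda$ assigns a multiplier $\Lambda(\boldsymbol s)\in\mathbb R$ to each joint state. It starts at an arbitrary $\Lambda_0$,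 and in each epoch $t=0,1,2,\dots$ a joint start state $\boldsymbol s$ is drawn uniformly at random, independently of the past; then, without imposing the budget, the arms are simulated independently for $K_t$ rounds from $\boldsymbol s$ under policies $\pi_{t,n}(\cdot\mid s,\lambda)$ at $\lambda=\Lambda_t(\boldsymbol s)$, which gives action costs $c_n^k$ ($0\le k<K_t$), and the entry at $\boldsymbol s$ is updated by $$\Lambda_{t+1}(\boldsymbol s)=\Lambda_t(\boldsymbol s)-\alpha_t\Big(\frac{B}{1-\beta}-\sum_{n=1}^N\sum_{k=0}^{K_t-1}\beta^kc_n^k\Big),$$ all other entries being unchanged. Assume that the arm policies correspond to the optimal $Q$-functions, i.e. each $\pi_{t,n}(\cdot\mid s,\lambda)$ is supported on the maximizers of $Q_n(s,\cdot,\lambda)$, and that the learning rates satisfy $\alpha_t\ge 0$, $\sum_t\alpha_t=\infty$ and $\sum_t\alpha_t^2<\infty$. Then $\Lambda^\star(\boldsymbol s)\ne\emptyset$ for every $\boldsymbol s$, and $\Lambda_t$ converges to the optimum as the number of epochs and the number of samples tend to infinity, in both of the following senses. (i) If $K_t\to\infty$, then almost surely, for every $\boldsymbol s$, $\operatorname{dist}(\Lambda_t(\boldsymbol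 s),\Lambda^\star(\boldsymbol s))\to0$ and $J(\boldsymbol s,\Lambda_t(\boldsymbol s))\to\min_\lambda J(\boldsymbol s,\lambda)$ as $t\to\infty$. (ii) For every $\varepsilon>0$ there is $K_0$ such that for every constant number of samples $K_t=K\ge K_0$, almost surely, for every $\boldsymbol s$ and all sufficiently large $t$, $\operatorname{dist}(\Lambda_t(\boldsymbol s),\Lambda^\star(\boldsymbol s))<\varepsilon$ and $J(\boldsymbol s,\Lambda_t(\boldsymbol s))<\min_\lambda J(\boldsymbol s,\lambda)+\varepsilon$. -/

import Mathlib

open Filter Topology MeasureTheory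

noncomputable section

namespace RMAB

/-- One arm: a finite Markov decision process with action costs and a passive action of cost `0`.
The reward depends on the state only. -/
structure Arm (S A : Type*) where
  passive : A
  cost : A → ℝ
  cost_passive : cost passive = 0
  trans : S → A → PMF S
  reward : S → ℝ

/-- A multi-action restless bandit: a family of arms, a common discount factor `β ∈ [0,1)` and a
budget `B ≥ 0` per round. -/
structure Bandit {ι : Type*} (S A : ι → Type*) where
  arm : ∀ n, Arm (S n) (A n)
  discount : ℝ
  discount_nonneg : 0 ≤ discount
  discount_lt_one : discount < 1
  budget : ℝ
  budget_nonneg : 0 ≤ budget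

section SingleArm

variable {S A : Type*} [Fintype S]

/-- The Bellman optimality operator of an arm whose actions are charged `lam` per unit of cost. -/
def bellman (arm : Arm S A) (β lam : ℝ) (Q : S → A → ℝ) : S → A → ℝ := fun s a =>
  arm.reward s - lam * arm.cost a + β * ∑ s', (arm.trans s a s').toReal * ⨆ a', Q s' a'

theorem sum_toReal_eq_one (p : PMF S) : ∑ s, (p s).toReal = 1 := by
  have h := p.tsum_coe
  rw [tsum_fintype] at h
  rw [← ENNReal.toReal_sum (fun s _ => p.apply_ne_top s), h, ENNReal.toReal_one]

variable [Fintype A]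

theorem abs_iSup_sub_iSup_le [Nonempty A] {f g : A → ℝ} {d : ℝ} (h : ∀ a, |f a - g a| ≤ d) :
    |(⨆ a, f a) - ⨆ a, g a| ≤ d := by
  have hf : BddAbove (Set.range f) := (Set.finite_range f).bddAbove
  have hg : BddAbove (Set.range g) := (Set.finite_range g).bddAbove
  rw [abs_sub_le_iff]
  constructor
  · rw [sub_le_iff_le_add]
    refine ciSup_le fun a => ?_
    have := (abs_le.mp (h a)).2
    linarith [le_ciSup hg a]
  · rw [sub_le_iff_le_add]
    refine ciSup_le fun a => ?_
    have := (abs_le.mp (h a)).1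
    linarith [le_ciSup hf a]

theorem bellman_contracting (arm : Arm S A) (β lam : ℝ) (h0 : 0 ≤ β) (h1 : β < 1) :
    ContractingWith β.toNNReal (bellman arm β lam) := by
  have : Nonempty A := ⟨arm.passive⟩
  refine ⟨by rw [← NNReal.coe_lt_coe, Real.coe_toNNReal β h0]; simpa using h1, ?_⟩
  refine LipschitzWith.of_dist_le_mul fun Q Q' => ?_
  rw [Real.coe_toNNReal β h0]
  have hd : 0 ≤ β * dist Q Q' := mul_nonneg h0 dist_nonneg
  refine (dist_pi_le_iff hd).2 fun s => (dist_pi_le_iff hd).2 fun a => ?_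
  rw [Real.dist_eq]
  have key : bellman arm β lam Q s a - bellman arm β lam Q' s a =
      β * ∑ s', (arm.trans s a s').toReal * ((⨆ a', Q s' a') - ⨆ a', Q' s' a') := by
    simp only [bellman, mul_sub, Finset.sum_sub_distrib]
    ring
  rw [key, abs_mul, abs_of_nonneg h0]
  refine mul_le_mul_of_nonneg_left ?_ h0
  calc |∑ s', (arm.trans s a s').toReal * ((⨆ a', Q s' a') - ⨆ a', Q' s' a')|
      ≤ ∑ s', |(arm.trans s a s').toReal * ((⨆ a', Q s' a') - ⨆ a', Q' s' a')| :=
        Finset.abs_sum_le_sum_abs _ _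
    _ ≤ ∑ s', (arm.trans s a s').toReal * dist Q Q' := by
        refine Finset.sum_le_sum fun s' _ => ?_
        rw [abs_mul, abs_of_nonneg ENNReal.toReal_nonneg]
        refine mul_le_mul_of_nonneg_left ?_ ENNReal.toReal_nonneg
        refine abs_iSup_sub_iSup_le fun a' => ?_
        rw [← Real.dist_eq]
        exact (dist_le_pi_dist (Q s') (Q' s') a').trans (dist_le_pi_dist Q Q' s')
    _ = dist Q Q' := by rw [← Finset.sum_mul, sum_toReal_eq_one, one_mul]

end SingleArm

section Product

variable {ι : Type*} [Fintype ι] {X : ι → Type*} [∀ n, Fintype (X n)]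

/-- The law of a family of independent draws, the `n`-th from `p n`. -/
def indep (p : ∀ n, PMF (X n)) : PMF (∀ n, X n) := by
  classical
  exact PMF.ofFintype (fun x => ∏ n, p n (x n)) (by
    rw [← Fintype.prod_sum]
    refine Finset.prod_eq_one fun n _ => ?_
    have h := (p n).tsum_coe
    rwa [tsum_fintype] at h)

end Product

namespace Bandit

variable {ι : Type*} {S A : ι → Type*}
  [∀ n, Fintype (S n)] [∀ n, Fintype (A n)] (M : Bandit S A)

/-- The optimal `Q`-function of arm `n` at charge `lam`: the unique solution of the Bellman
optimality equation. -/
def optimalQ (n : ι) (lam : ℝ) : S n → A n → ℝ :=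
  (bellman_contracting (M.arm n) M.discount lam M.discount_nonneg
    M.discount_lt_one).fixedPoint

/-- The Bellman optimality equation. -/
theorem optimalQ_eq (n : ι) (lam : ℝ) (s : S n) (a : A n) :
    M.optimalQ n lam s a = (M.arm n).reward s - lam * (M.arm n).cost a +
      M.discount * ∑ s', ((M.arm n).trans s a s').toReal * ⨆ a', M.optimalQ n lam s' a' :=
  (congrFun (congrFun (bellman_contracting (M.arm n) M.discount lam M.discount_nonneg
    M.discount_lt_one).fixedPoint_isFixedPt s) a).symm

theorem optimalQ_unique (n : ι) (lam : ℝ) (Q : S n → A n → ℝ)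
    (hQ : bellman (M.arm n) M.discount lam Q = Q) : Q = M.optimalQ n lam :=
  (bellman_contracting (M.arm n) M.discount lam M.discount_nonneg
    M.discount_lt_one).fixedPoint_unique hQ

variable [Fintype ι]

/-- The relaxed objective at joint state `s`, as a function of the multiplier `lam`. -/
def objective (s : ∀ n, S n) (lam : ℝ) : ℝ :=
  lam * M.budget / (1 - M.discount) + ∑ n, ⨆ a, M.optimalQ n lam (s n) a

/-- The optimal multipliers at joint state `s`. -/
def optimalMultipliers (s : ∀ n, S n) : Set ℝ :=
  {lam | ∀ lam', M.objective s lam ≤ M.objective s lam'}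

/-- Arm policies that take the multiplier as an input (`π n lam s` is the action distribution). -/
abbrev Policies (S A : ι → Type*) := ∀ n, ℝ → S n → PMF (A n)

/-- The policies play only actions that maximize the optimal `Q`-function (ties broken in any,
possibly random, way). -/
def IsOptimal (π : Policies S A) : Prop :=
  ∀ n lam s, ∀ a ∈ (π n lam s).support, ∀ a', M.optimalQ n lam s a' ≤ M.optimalQ n lam s a

/-- The joint actions of the first `K` rounds when the arms, started in `s`, follow their policies
at multiplier `lam`, independently and without any budget constraint. -/
def rollout (π : Policies S A) (lam : ℝ) :
    (K : ℕ) → (∀ n, S n) → PMF (Fin K → ∀ n, A n)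
  | 0, _ => PMF.pure Fin.elim0
  | K + 1, s =>
    (indep fun n => π n lam (s n)).bind fun a =>
      (indep fun n => (M.arm n).trans (s n) (a n)).bind fun s' =>
        (rollout π lam K s').map fun as => Fin.cons a as

/-- The sampled value of `D_n`: the negative of the discounted action costs of arm `n` in the
rounds `0, …, K-1` of a rollout. -/
def sampledD {K : ℕ} (as : Fin K → ∀ n, A n) (n : ι) : ℝ :=
  -∑ k : Fin K, M.discount ^ (k : ℕ) * (M.arm n).cost (as k n)

open Classical in
/-- The `lam`-update with learning rate `α` at joint state `s`, from a rollout started in `s`. The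
multiplier function `L` is a table with one entry for each joint state. -/
def update (α : ℝ) {K : ℕ} (as : Fin K → ∀ n, A n) (s : ∀ n, S n) (L : (∀ n, S n) → ℝ) :
    (∀ n, S n) → ℝ :=
  Function.update L s
    (L s - α * (M.budget / (1 - M.discount) + ∑ n, M.sampledD as n))

open Classical in
/-- The law of the multiplier table after one training epoch that begins with the table `L`: draw a
start state uniformly, roll out the policies for `K` rounds at its multiplier, update. -/
def epoch [∀ n, Nonempty (S n)] (π : Policies S A) (α : ℝ) (K : ℕ) (L : (∀ n, S n) → ℝ) :
    PMF ((∀ n, S n) → ℝ) :=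
  (PMF.uniformOfFintype (∀ n, S n)).bind fun s =>
    (M.rollout π (L s) K s).map fun as => M.update α as s L

/-- `L 0, L 1, …` are the multiplier tables of a training run: a Markov chain started in `L₀`, whose
`t`-th transition is an epoch with policies `π t`, learning rate `α t` and `K t` rounds. Each `L t`
takes finitely many values, so that the law is determined by the probabilities of the finite
histories `l 0, …, l t`. -/
structure IsTrainingRun [∀ n, Nonempty (S n)] (π : ℕ → Policies S A) (α : ℕ → ℝ) (K : ℕ → ℕ)
    (L₀ : (∀ n, S n) → ℝ) {Ω : Type*} [MeasurableSpace Ω] (μ : Measure Ω)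
    (L : ℕ → Ω → (∀ n, S n) → ℝ) : Prop where
  measurable : ∀ t, Measurable (L t)
  initial : ∀ᵐ ω ∂μ, L 0 ω = L₀
  transition : ∀ (t : ℕ) (l : ℕ → (∀ n, S n) → ℝ),
    μ {ω | ∀ i ≤ t + 1, L i ω = l i} =
      μ {ω | ∀ i ≤ t, L i ω = l i} * M.epoch (π t) (α t) (K t) (l t) (l (t + 1))

end Bandit

end RMAB

end

/-!
# Convergence of the multipliers of a multi-action restless bandit

Fix a joint state `s`. For each multiplier the greedy stationary deterministic policies stay
available at every other charge, where their value is affine, with slope minus their discounted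
cost. As there are only finitely many such policies, the objective is a maximum of finitely many
affine functions (`SupportedBy`, `exists_finite_objective_supportedBy`). The budget assumptions
bound it from below (`exists_le_objective`). So it attains its minimum, and the minimum is sharp:
the objective exceeds it by at least `δ` times the distance `gap` of the multiplier from the set of
minimizers (`exists_sharp_objective`).

A rollout of `K` rounds under an optimal policy samples a subgradient of the objective up to a bias
of order `β ^ K` (`sum_value_add_expect_sampledD_le`). Once this bias is below `δ / 2`, the expected
update pushes the multiplier towards the nearest minimizer with force at least `δ / 2`, so that in
one epoch with learning rate `α` the expectation of `gap ^ 2` changes by at most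
`α ^ 2 * C - κ * α * gap` (`exists_tsum_epoch_gap_sq_le`). In particular a fixed, large enough number
of rounds already gives convergence to the exact minimizers, and both claims have the same proof.

A training run almost surely stays in a countable set of tables, so the drift inequality integrates
over the events of the past (`setLIntegral_drift_le`), and the Robbins–Siegmund argument
(`ae_tendsto_and_summable_of_drift`) shows that almost surely `gap ^ 2` converges and
`∑ α t * gap t` is finite. As `∑ α t` diverges, the limit is `0`; the objective, being Lipschitz,
converges to its minimum.
-/

/-! ### Convex functions on the line with finitely many slopes -/

namespace RMAB

/-- Every point of the line has a supporting line of `f` whose slope lies in `P`. For a finite `P`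
this says that `f` is a maximum of finitely many affine functions. -/
def SupportedBy (f : ℝ → ℝ) (P : Set ℝ) : Prop :=
  ∀ x, ∃ p ∈ P, ∀ y, f x + p * (y - x) ≤ f y

theorem _root_.Set.Finite.exists_pos_le_abs {P : Set ℝ} (hP : P.Finite) :
    ∃ δ : ℝ, 0 < δ ∧ ∀ p ∈ P, p ≠ 0 → δ ≤ |p| := by
  induction P, hP using Set.Finite.induction_on with
  | empty => exact ⟨1, one_pos, by simp⟩
  | @insert a P _ _ ih =>
    obtain ⟨δ, hδ, h⟩ := ih
    by_cases ha : a = 0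
    · refine ⟨δ, hδ, fun p hp h0 => ?_⟩
      rcases hp with rfl | hp
      exacts [absurd ha h0, h p hp h0]
    · refine ⟨min δ |a|, lt_min hδ (abs_pos.2 ha), fun p hp h0 => ?_⟩
      rcases hp with rfl | hp
      exacts [min_le_right _ _, (min_le_left _ _).trans (h p hp h0)]

namespace SupportedBy

variable {f : ℝ → ℝ} {P : Set ℝ}

theorem abs_sub_le (hf : SupportedBy f P) {C : ℝ} (hC : ∀ p ∈ P, |p| ≤ C) (x y : ℝ) :
    |f x - f y| ≤ C * |x - y| := by
  have key : ∀ x y, f x - f y ≤ C * |x - y| := fun x y => by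
    obtain ⟨p, hp, h⟩ := hf x
    calc f x - f y ≤ p * (x - y) := by linarith [h y]
      _ ≤ |p| * |x - y| := by rw [← abs_mul]; exact le_abs_self _
      _ ≤ C * |x - y| := mul_le_mul_of_nonneg_right (hC p hp) (abs_nonneg _)
  rw [abs_sub_le_iff]
  exact ⟨key x y, abs_sub_comm x y ▸ key y x⟩

theorem continuous (hf : SupportedBy f P) (hP : P.Finite) : Continuous f := by
  obtain ⟨C, hC⟩ := (hP.image fun p => |p|).bddAbove
  have hC' : ∀ p ∈ P, |p| ≤ C := fun p hp => hC ⟨p, hp, rfl⟩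
  refine (LipschitzWith.of_dist_le_mul (K := C.toNNReal) fun x y => ?_).continuous
  rw [Real.dist_eq, Real.dist_eq]
  exact (hf.abs_sub_le hC' x y).trans
    (mul_le_mul_of_nonneg_right (Real.le_coe_toNNReal C) (abs_nonneg _))

/-- A function that is bounded below has a point with a supporting slope `≤ 0`: otherwise all
slopes exceed some `δ > 0` and the function tends to `-∞` on the left. -/
theorem exists_forall_le_of_le (hf : SupportedBy f P) (hP : P.Finite) {m : ℝ}
    (hm : ∀ x, m ≤ f x) : ∃ x, ∀ y ≤ x, f x ≤ f y := by
  obtain ⟨δ, hδ, hPδ⟩ := hP.exists_pos_le_abs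
  by_contra! hcon
  -- so far to the left that a slope `≥ δ` would push `f` below `m`
  set x : ℝ := -((f 0 - m + 1) / δ) with hx
  have hx0 : x < 0 := by
    have : 0 < f 0 - m + 1 := by linarith [hm 0]
    rw [hx, neg_lt_zero]
    positivity
  obtain ⟨p, hp, h⟩ := hf x
  have hpos : 0 < p := by
    by_contra! hp0
    obtain ⟨y, hy, hlt⟩ := hcon x
    nlinarith [h y, mul_nonneg_of_nonpos_of_nonpos hp0 (sub_nonpos.2 hy)]
  have hδp : δ ≤ p := by simpa [abs_of_pos hpos] using hPδ p hp hpos.ne'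
  have h1 : δ * (0 - x) ≤ p * (0 - x) := mul_le_mul_of_nonneg_right hδp (by linarith)
  have h2 : δ * (0 - x) = f 0 - m + 1 := by
    rw [hx]; field_simp; ring
  linarith [h 0, hm x]

theorem comp_neg (hf : SupportedBy f P) : SupportedBy (fun x => f (-x)) (-P) := fun x => by
  obtain ⟨p, hp, h⟩ := hf (-x)
  exact ⟨-p, by simpa using hp, fun y => by linarith [h (-y)]⟩

theorem exists_isMinOn (hf : SupportedBy f P) (hP : P.Finite) {m : ℝ} (hm : ∀ x, m ≤ f x) :
    ∃ x, ∀ y, f x ≤ f y := by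
  obtain ⟨a, ha⟩ := hf.exists_forall_le_of_le hP hm
  obtain ⟨b', hb'⟩ := hf.comp_neg.exists_forall_le_of_le hP.neg (fun x => hm (-x))
  obtain ⟨b, hb⟩ : ∃ b, ∀ y ≥ b, f b ≤ f y :=
    ⟨-b', fun y hy => by simpa using hb' (-y) (by linarith)⟩
  obtain ⟨z, -, hz⟩ := (isCompact_uIcc (a := a) (b := b)).exists_isMinOn
    ⟨a, Set.left_mem_uIcc⟩ (hf.continuous hP).continuousOn
  refine ⟨z, fun y => ?_⟩
  have hza : f z ≤ f a := hz Set.left_mem_uIcc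
  have hzb : f z ≤ f b := hz Set.right_mem_uIcc
  by_cases h1 : y ≤ a
  · exact hza.trans (ha y h1)
  by_cases h2 : b ≤ y
  · exact hzb.trans (hb y h2)
  push Not at h1 h2
  exact hz (Set.mem_uIcc.2 (Or.inl ⟨h1.le, h2.le⟩))

/-- Away from the set of minimizers the slopes are at least the smallest nonzero modulus in `P`, so
that the minimum is sharp: the function grows linearly with the distance to that set. -/
theorem exists_sharp (hf : SupportedBy f P) (hP : P.Finite) :
    ∃ δ : ℝ, 0 < δ ∧ ∀ z, (∀ y, f z ≤ f y) → ∀ x,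
      f z + δ * Metric.infDist x {x | ∀ y, f x ≤ f y} ≤ f x := by
  obtain ⟨δ, hδ, hPδ⟩ := hP.exists_pos_le_abs
  refine ⟨δ, hδ, fun z hz x => ?_⟩
  set S := {x | ∀ y, f x ≤ f y} with hS
  set d := Metric.infDist x S with hd
  -- on points nearer than `d` to `x` the function is not minimal
  have hne : ∀ w, |x - w| < d → f z < f w := fun w hw => by
    by_contra! hle
    have hwS : w ∈ S := fun y => hle.trans (hz y)
    have hle' : d ≤ dist x w := Metric.infDist_le_dist_of_mem hwS
    rw [Real.dist_eq] at hle'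
    linarith
  rcases (Metric.infDist_nonneg (x := x) (s := S)).eq_or_lt with h0 | h0
  · rw [hd, ← h0]; simpa using hz x
  have hzS : z ∈ S := hz
  have hdz : d ≤ |x - z| := by rw [← Real.dist_eq]; exact Metric.infDist_le_dist_of_mem hzS
  have key : ∀ e, 0 ≤ e → e < d → f z + δ * e ≤ f x := fun e he hed => by
    rcases le_total z x with hzx | hzx
    · rw [abs_of_nonneg (by linarith)] at hdz
      have hw := hne (x - e) (by rwa [sub_sub_cancel, abs_of_nonneg he])
      obtain ⟨p, hp, h⟩ := hf (x - e)
      have hpos : 0 < p := by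
        by_contra! hp0
        nlinarith [h z, mul_nonneg_of_nonpos_of_nonpos hp0 (by linarith : z - (x - e) ≤ 0)]
      have hδp : δ ≤ p := by simpa [abs_of_pos hpos] using hPδ p hp hpos.ne'
      nlinarith [h x, mul_le_mul_of_nonneg_right hδp he]
    · rw [abs_of_nonpos (by linarith)] at hdz
      have hw := hne (x + e) (by rw [sub_add_cancel_left, abs_neg, abs_of_nonneg he]; exact hed)
      obtain ⟨p, hp, h⟩ := hf (x + e)
      have hneg : p < 0 := by
        by_contra! hp0
        nlinarith [h z, mul_nonneg hp0 (by linarith : 0 ≤ z - (x + e))]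
      have hδp : δ ≤ -p := by simpa [abs_of_neg hneg] using hPδ p hp hneg.ne
      nlinarith [h x, mul_le_mul_of_nonneg_right hδp he]
  have hlim : Tendsto (fun e => f z + δ * e) (𝓝[<] d) (𝓝 (f z + δ * d)) :=
    ((continuous_const.add (continuous_const.mul continuous_id)).tendsto d).mono_left
      nhdsWithin_le_nhds
  refine le_of_tendsto hlim ?_
  filter_upwards [Ioo_mem_nhdsLT h0] with e he using key e he.1.le he.2

end SupportedBy

end RMAB

/-! ### The relaxed objective as a maximum of finitely many affine functions -/

namespace RMAB

section SingleArm

variable {S A : Type*} [Fintype S]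

/-- The expected discounted cost of a stationary deterministic policy `σ` solves its evaluation
equation. It is obtained from the optimality equation of the arm whose only action is to follow `σ`
and whose rewards are the costs of `σ`. -/
theorem exists_policyCost (arm : Arm S A) {β : ℝ} (h0 : 0 ≤ β) (h1 : β < 1) (σ : S → A) :
    ∃ D : S → ℝ, ∀ s, D s = arm.cost (σ s) + β * ∑ s', (arm.trans s (σ s) s').toReal * D s' := by
  let arm' : Arm S Unit :=
    { passive := (), cost := 0, cost_passive := rfl
      trans := fun s _ => arm.trans s (σ s), reward := fun s => arm.cost (σ s) }
  obtain ⟨Q, hQ⟩ : ∃ Q, bellman arm' β 0 Q = Q :=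
    ⟨_, (bellman_contracting arm' β 0 h0 h1).fixedPoint_isFixedPt⟩
  refine ⟨fun s => Q s (), fun s => ?_⟩
  have h := congrFun (congrFun hQ s) ()
  simpa [bellman, arm'] using h.symm

/-- A function that dominates its discounted average under a transition matrix is nonnegative. -/
theorem nonneg_of_discounted_average_le {β : ℝ} (h0 : 0 ≤ β) (h1 : β < 1) (T : S → PMF S)
    (h : S → ℝ) (hh : ∀ s, β * ∑ s', (T s s').toReal * h s' ≤ h s) (s : S) : 0 ≤ h s := by
  have : Nonempty S := ⟨s⟩
  obtain ⟨s₀, hs₀⟩ := Finite.exists_min h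
  have h2 : h s₀ ≤ ∑ s', (T s₀ s').toReal * h s' := by
    calc h s₀ = ∑ s', (T s₀ s').toReal * h s₀ := by
          rw [← Finset.sum_mul, sum_toReal_eq_one, one_mul]
      _ ≤ _ := Finset.sum_le_sum fun s' _ =>
          mul_le_mul_of_nonneg_left (hs₀ s') ENNReal.toReal_nonneg
  have h3 : β * h s₀ ≤ h s₀ := (mul_le_mul_of_nonneg_left h2 h0).trans (hh s₀)
  have h4 : 0 ≤ h s₀ := by
    by_contra! hneg
    nlinarith
  exact h4.trans (hs₀ s)

end SingleArm

namespace Bandit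

variable {ι : Type*} {S A : ι → Type*}
  [∀ n, Fintype (S n)] (M : Bandit S A)

/-- The expected discounted cost of arm `n` under the stationary deterministic policy `σ`. -/
noncomputable def policyCost (n : ι) (σ : S n → A n) : S n → ℝ :=
  (exists_policyCost (M.arm n) M.discount_nonneg M.discount_lt_one σ).choose

theorem policyCost_eq (n : ι) (σ : S n → A n) (s : S n) :
    M.policyCost n σ s = (M.arm n).cost (σ s) +
      M.discount * ∑ s', ((M.arm n).trans s (σ s) s').toReal * M.policyCost n σ s' :=
  (exists_policyCost (M.arm n) M.discount_nonneg M.discount_lt_one σ).choose_spec s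

variable [∀ n, Fintype (A n)]

/-- The optimal value of arm `n` in state `s` at charge `lam`. -/
noncomputable def value (n : ι) (lam : ℝ) (s : S n) : ℝ := ⨆ a, M.optimalQ n lam s a

theorem optimalQ_le_value (n : ι) (lam : ℝ) (s : S n) (a : A n) :
    M.optimalQ n lam s a ≤ M.value n lam s :=
  le_ciSup (Set.finite_range _).bddAbove a

theorem optimalQ_eq_value {n : ι} {lam : ℝ} {s : S n} {a : A n}
    (h : ∀ a', M.optimalQ n lam s a' ≤ M.optimalQ n lam s a) :
    M.optimalQ n lam s a = M.value n lam s :=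
  have : Nonempty (A n) := ⟨a⟩
  le_antisymm (M.optimalQ_le_value n lam s a) (ciSup_le h)

theorem optimalQ_eq_add_value (n : ι) (lam : ℝ) (s : S n) (a : A n) :
    M.optimalQ n lam s a = (M.arm n).reward s - lam * (M.arm n).cost a +
      M.discount * ∑ s', ((M.arm n).trans s a s').toReal * M.value n lam s' :=
  M.optimalQ_eq n lam s a

/-- The greedy policy at charge `lam` remains available at charge `y`, where its value differs by
`-(y - lam)` times its discounted cost. So its discounted cost is minus a supporting slope of the
optimal value, and there are only finitely many such policies. -/
theorem exists_policyCost_support (n : ι) (lam : ℝ) :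
    ∃ σ : S n → A n, ∀ y s,
      M.value n lam s + -M.policyCost n σ s * (y - lam) ≤ M.value n y s := by
  have : Nonempty (A n) := ⟨(M.arm n).passive⟩
  choose σ hσ using fun s : S n => exists_eq_ciSup_of_finite (f := M.optimalQ n lam s)
  refine ⟨σ, fun y s => ?_⟩
  suffices h : 0 ≤ M.value n y s - M.value n lam s + M.policyCost n σ s * (y - lam) by linarith
  refine nonneg_of_discounted_average_le M.discount_nonneg M.discount_lt_one
    (fun s => (M.arm n).trans s (σ s))
    (fun s => M.value n y s - M.value n lam s + M.policyCost n σ s * (y - lam)) (fun s => ?_) s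
  have h1 := M.optimalQ_le_value n y s (σ s)
  have h2 : M.optimalQ n lam s (σ s) = M.value n lam s := hσ s
  rw [optimalQ_eq_add_value] at h1 h2
  have h3 := M.policyCost_eq n σ s
  have h4 : ∑ s', ((M.arm n).trans s (σ s) s').toReal *
      (M.value n y s' - M.value n lam s' + M.policyCost n σ s' * (y - lam)) =
      ∑ s', ((M.arm n).trans s (σ s) s').toReal * M.value n y s' -
      ∑ s', ((M.arm n).trans s (σ s) s').toReal * M.value n lam s' +
      (∑ s', ((M.arm n).trans s (σ s) s').toReal * M.policyCost n σ s') * (y - lam) := by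
    rw [Finset.sum_mul, ← Finset.sum_sub_distrib, ← Finset.sum_add_distrib]
    exact Finset.sum_congr rfl fun _ _ => by ring
  rw [h4, ← h2, h3]
  linear_combination h1

/-- Playing the constant action `a` bounds the value from below. -/
theorem le_value_of_constant_action (n : ι) (a : A n) {r : ℝ} (hr : ∀ s, r ≤ (M.arm n).reward s)
    (lam : ℝ) (s : S n) :
    (r - lam * (M.arm n).cost a) / (1 - M.discount) ≤ M.value n lam s := by
  have hb : 0 < 1 - M.discount := by linarith [M.discount_lt_one]
  set v := (r - lam * (M.arm n).cost a) / (1 - M.discount) with hv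
  have hv' : v = r - lam * (M.arm n).cost a + M.discount * v := by
    rw [hv]; field_simp; ring
  have := nonneg_of_discounted_average_le M.discount_nonneg M.discount_lt_one
    (fun s => (M.arm n).trans s a) (fun s => M.value n lam s - v) (fun s => ?_) s
  · linarith
  have h1 := M.optimalQ_le_value n lam s a
  rw [optimalQ_eq_add_value] at h1
  simp only [mul_sub, Finset.sum_sub_distrib, ← Finset.sum_mul, sum_toReal_eq_one, one_mul]
  linarith [hr s]

variable [Fintype ι]

theorem objective_eq (s : ∀ n, S n) (lam : ℝ) :
    M.objective s lam = lam * M.budget / (1 - M.discount) + ∑ n, M.value n lam (s n) := rfl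

theorem exists_sum_policyCost_support (lam : ℝ) :
    ∃ σ : ∀ n, S n → A n, ∀ (y : ℝ) (s : ∀ n, S n),
      ∑ n, M.value n lam (s n) + -(∑ n, M.policyCost n (σ n) (s n)) * (y - lam) ≤
        ∑ n, M.value n y (s n) := by
  choose σ hσ using fun n => M.exists_policyCost_support n lam
  refine ⟨σ, fun y s => ?_⟩
  rw [neg_mul, Finset.sum_mul, ← Finset.sum_neg_distrib, ← Finset.sum_add_distrib]
  exact Finset.sum_le_sum fun n _ => by simpa using hσ n y (s n)

theorem exists_finite_objective_supportedBy (s : ∀ n, S n) :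
    ∃ P : Set ℝ, P.Finite ∧ SupportedBy (M.objective s) P := by
  refine ⟨_, Set.finite_range fun σ : ∀ n, S n → A n =>
    M.budget / (1 - M.discount) - ∑ n, M.policyCost n (σ n) (s n), fun lam => ?_⟩
  obtain ⟨σ, hσ⟩ := M.exists_sum_policyCost_support lam
  refine ⟨_, ⟨σ, rfl⟩, fun y => ?_⟩
  rw [objective_eq, objective_eq]
  linear_combination hσ y s

theorem exists_abs_sum_value_sub_le :
    ∃ C : ℝ, 0 ≤ C ∧ ∀ (s : ∀ n, S n) (x y : ℝ),
      |∑ n, M.value n x (s n) - ∑ n, M.value n y (s n)| ≤ C * |x - y| := by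
  obtain ⟨C, hC⟩ := (Set.finite_range fun p : (∀ n, S n → A n) × (∀ n, S n) =>
    |∑ n, M.policyCost n (p.1 n) (p.2 n)|).bddAbove
  refine ⟨max C 0, le_max_right _ _, fun s x y => ?_⟩
  refine SupportedBy.abs_sub_le (f := fun x => ∑ n, M.value n x (s n))
    (P := Set.range fun σ : ∀ n, S n → A n => -∑ n, M.policyCost n (σ n) (s n)) ?_ ?_ x y
  · intro lam
    obtain ⟨σ, hσ⟩ := M.exists_sum_policyCost_support lam
    exact ⟨_, ⟨σ, rfl⟩, fun y => hσ y s⟩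
  · rintro _ ⟨σ, rfl⟩
    rw [abs_neg]
    exact (hC ⟨(σ, s), rfl⟩).trans (le_max_left _ _)

/-- For multipliers `≥ 0` the passive actions bound the objective from below, and for multipliers
`≤ 0` actions whose joint cost reaches the budget. -/
theorem exists_le_objective (hB : ∃ a : ∀ n, A n, M.budget ≤ ∑ n, (M.arm n).cost (a n))
    (s : ∀ n, S n) : ∃ m, ∀ lam, m ≤ M.objective s lam := by
  have hb : 0 < 1 - M.discount := by linarith [M.discount_lt_one]
  choose r hr using fun n => (Set.finite_range (M.arm n).reward).bddBelow
  have key : ∀ (a : ∀ n, A n) lam, lam * (∑ n, (M.arm n).cost (a n)) ≤ lam * M.budget →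
      (∑ n, r n) / (1 - M.discount) ≤ M.objective s lam := fun a lam h => by
    have h1 : ∑ n, (r n - lam * (M.arm n).cost (a n)) / (1 - M.discount) ≤
        ∑ n, M.value n lam (s n) := Finset.sum_le_sum fun n _ =>
      M.le_value_of_constant_action n (a n) (fun s => hr n ⟨s, rfl⟩) lam (s n)
    rw [← Finset.sum_div, Finset.sum_sub_distrib, ← Finset.mul_sum] at h1
    rw [objective_eq]
    refine le_trans ?_ (add_le_add_right h1 _)
    rw [← add_div]
    exact div_le_div_of_nonneg_right (by linarith) hb.le
  refine ⟨(∑ n, r n) / (1 - M.discount), fun lam => ?_⟩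
  rcases le_total 0 lam with h | h
  · refine key (fun n => (M.arm n).passive) lam ?_
    simpa [Arm.cost_passive] using mul_nonneg h M.budget_nonneg
  · obtain ⟨a, ha⟩ := hB
    exact key a lam (mul_le_mul_of_nonpos_left ha h)

theorem optimalMultipliers_nonempty
    (hB : ∃ a : ∀ n, A n, M.budget ≤ ∑ n, (M.arm n).cost (a n)) (s : ∀ n, S n) :
    (M.optimalMultipliers s).Nonempty := by
  obtain ⟨P, hP, hJ⟩ := M.exists_finite_objective_supportedBy s
  obtain ⟨m, hm⟩ := M.exists_le_objective hB s
  exact hJ.exists_isMinOn hP hm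

theorem continuous_objective (s : ∀ n, S n) : Continuous (M.objective s) := by
  obtain ⟨P, hP, hJ⟩ := M.exists_finite_objective_supportedBy s
  exact hJ.continuous hP

theorem isClosed_optimalMultipliers (s : ∀ n, S n) : IsClosed (M.optimalMultipliers s) := by
  simp only [optimalMultipliers, Set.ofPred_forall]
  exact isClosed_iInter fun y => isClosed_le (M.continuous_objective s) continuous_const

/-- The distance of a multiplier from the optimal ones at joint state `s`. -/
noncomputable def gap (s : ∀ n, S n) (lam : ℝ) : ℝ := Metric.infDist lam (M.optimalMultipliers s)

theorem gap_nonneg (s : ∀ n, S n) (lam : ℝ) : 0 ≤ M.gap s lam := Metric.infDist_nonneg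

theorem continuous_gap (s : ∀ n, S n) : Continuous (M.gap s) := Metric.continuous_infDist_pt _

theorem gap_le_abs_sub {s : ∀ n, S n} {y : ℝ} (hy : y ∈ M.optimalMultipliers s) (lam : ℝ) :
    M.gap s lam ≤ |lam - y| :=
  Real.dist_eq lam y ▸ Metric.infDist_le_dist_of_mem hy

theorem exists_gap_eq (hB : ∃ a : ∀ n, A n, M.budget ≤ ∑ n, (M.arm n).cost (a n))
    (s : ∀ n, S n) (lam : ℝ) : ∃ y ∈ M.optimalMultipliers s, M.gap s lam = |lam - y| := by
  simp only [← Real.dist_eq]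
  exact (M.isClosed_optimalMultipliers s).exists_infDist_eq_dist
    (M.optimalMultipliers_nonempty hB s) lam

theorem exists_sharp_objective [∀ n, Nonempty (S n)] :
    ∃ δ : ℝ, 0 < δ ∧ ∀ s, ∀ y ∈ M.optimalMultipliers s, ∀ lam,
      M.objective s y + δ * M.gap s lam ≤ M.objective s lam := by
  choose P hP hJ using fun s => M.exists_finite_objective_supportedBy s
  choose δ hδ h using fun s => (hJ s).exists_sharp (hP s)
  obtain ⟨s₀, hs₀⟩ := Finite.exists_min δ
  refine ⟨δ s₀, hδ s₀, fun s y hy lam => le_trans ?_ (h s y hy lam)⟩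
  have := mul_le_mul_of_nonneg_right (hs₀ s) (M.gap_nonneg s lam)
  simpa [gap, optimalMultipliers] using this

theorem iInf_objective {s : ∀ n, S n} {y : ℝ} (hy : y ∈ M.optimalMultipliers s) :
    ⨅ lam, M.objective s lam = M.objective s y :=
  le_antisymm (ciInf_le ⟨_, Set.forall_mem_range.2 hy⟩ y) (le_ciInf hy)

theorem exists_abs_objective_sub_iInf_le
    (hB : ∃ a : ∀ n, A n, M.budget ≤ ∑ n, (M.arm n).cost (a n)) (s : ∀ n, S n) :
    ∃ C : ℝ, ∀ lam, |M.objective s lam - ⨅ lam, M.objective s lam| ≤ C * M.gap s lam := by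
  obtain ⟨P, hP, hJ⟩ := M.exists_finite_objective_supportedBy s
  obtain ⟨C, hC⟩ := (hP.image fun p => |p|).bddAbove
  refine ⟨C, fun lam => ?_⟩
  obtain ⟨y, hy, hgap⟩ := M.exists_gap_eq hB s lam
  rw [M.iInf_objective hy, hgap]
  exact hJ.abs_sub_le (fun p hp => hC ⟨p, hp, rfl⟩) lam y

end Bandit

end RMAB

/-! ### Expectations of rollouts -/

namespace RMAB

section Expectation

variable {X Y : Type*} [Fintype X] [Fintype Y]

/-- The expectation of a real function under a distribution on a finite type. -/
noncomputable def expect (p : PMF X) (F : X → ℝ) : ℝ := ∑ x, (p x).toReal * F x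

theorem expect_const (p : PMF X) (c : ℝ) : expect p (fun _ => c) = c := by
  rw [expect, ← Finset.sum_mul, sum_toReal_eq_one, one_mul]

theorem expect_add (p : PMF X) (F G : X → ℝ) :
    expect p (fun x => F x + G x) = expect p F + expect p G := by
  simp only [expect, mul_add, Finset.sum_add_distrib]

theorem expect_const_mul (p : PMF X) (c : ℝ) (F : X → ℝ) :
    expect p (fun x => c * F x) = c * expect p F := by
  simp only [expect, Finset.mul_sum]
  exact Finset.sum_congr rfl fun _ _ => by ring

theorem expect_sum {κ : Type*} (p : PMF X) (s : Finset κ) (F : κ → X → ℝ) :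
    expect p (fun x => ∑ i ∈ s, F i x) = ∑ i ∈ s, expect p (F i) := by
  simp only [expect, Finset.mul_sum]
  exact Finset.sum_comm

theorem expect_mono_of_support {p : PMF X} {F G : X → ℝ} (h : ∀ x ∈ p.support, F x ≤ G x) :
    expect p F ≤ expect p G := by
  refine Finset.sum_le_sum fun x _ => ?_
  by_cases hx : p x = 0
  · simp [hx]
  · exact mul_le_mul_of_nonneg_left (h x hx) ENNReal.toReal_nonneg

theorem expect_mono {p : PMF X} {F G : X → ℝ} (h : ∀ x, F x ≤ G x) : expect p F ≤ expect p G :=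
  expect_mono_of_support fun x _ => h x

theorem expect_nonneg {p : PMF X} {F : X → ℝ} (h : ∀ x, 0 ≤ F x) : 0 ≤ expect p F :=
  Finset.sum_nonneg fun x _ => mul_nonneg ENNReal.toReal_nonneg (h x)

theorem expect_bind (p : PMF X) (q : X → PMF Y) (F : Y → ℝ) :
    expect (p.bind q) F = expect p fun x => expect (q x) F := by
  have h : ∀ y, ((p.bind q) y).toReal = ∑ x, (p x).toReal * (q x y).toReal := fun y => by
    rw [PMF.bind_apply, tsum_fintype,
      ENNReal.toReal_sum fun x _ => ENNReal.mul_ne_top (p.apply_ne_top x) ((q x).apply_ne_top y)]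
    simp
  simp only [expect, h, Finset.sum_mul, Finset.mul_sum]
  rw [Finset.sum_comm]
  exact Finset.sum_congr rfl fun _ _ => Finset.sum_congr rfl fun _ _ => by ring

theorem expect_pure (x : X) (F : X → ℝ) : expect (PMF.pure x) F = F x := by
  rw [expect, Finset.sum_eq_single x]
  · simp
  · intro y _ hy
    simp [PMF.pure_apply, hy]
  · simp

theorem expect_map (p : PMF X) (g : X → Y) (F : Y → ℝ) :
    expect (p.map g) F = expect p fun x => F (g x) := by
  rw [PMF.map, expect_bind]
  simp only [Function.comp_apply, expect_pure]

theorem tsum_mul_ofReal (p : PMF X) {F : X → ℝ} (hF : ∀ x, 0 ≤ F x) :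
    ∑' x, p x * ENNReal.ofReal (F x) = ENNReal.ofReal (expect p F) := by
  rw [tsum_fintype, expect,
    ENNReal.ofReal_sum_of_nonneg fun x _ => mul_nonneg ENNReal.toReal_nonneg (hF x)]
  refine Finset.sum_congr rfl fun x _ => ?_
  rw [ENNReal.ofReal_mul ENNReal.toReal_nonneg, ENNReal.ofReal_toReal (p.apply_ne_top x)]

end Expectation

section Product

variable {ι : Type*} [Fintype ι] {X : ι → Type*} [∀ n, Fintype (X n)]

theorem indep_apply (p : ∀ n, PMF (X n)) (x : ∀ n, X n) : indep p x = ∏ n, p n (x n) := rfl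

theorem mem_support_of_mem_support_indep {p : ∀ n, PMF (X n)} {x : ∀ n, X n}
    (hx : x ∈ (indep p).support) (n : ι) : x n ∈ (p n).support := by
  rw [PMF.mem_support_iff, indep_apply, Finset.prod_ne_zero_iff] at hx
  exact hx n (Finset.mem_univ n)

open Classical in
theorem expect_indep (p : ∀ n, PMF (X n)) (m : ι) (h : X m → ℝ) :
    expect (indep p) (fun x => h (x m)) = expect (p m) h := by
  set g : ∀ n, X n → ℝ := Function.update (fun n _ => 1) m h with hg
  have hgm : g m = h := by simp [hg]
  have hgn : ∀ n, n ≠ m → g n = fun _ => 1 := fun n hn => by simp [hg, hn]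
  have h1 : ∀ x : ∀ n, X n, (indep p x).toReal * h (x m) = ∏ n, ((p n (x n)).toReal * g n (x n)) :=
    fun x => by
      rw [Finset.prod_mul_distrib, indep_apply, ENNReal.toReal_prod,
        Finset.prod_eq_single (f := fun n => g n (x n)) m (fun n _ hn => by rw [hgn n hn])
          (by simp), hgm]
  rw [expect, Finset.sum_congr rfl fun x _ => h1 x,
    ← Fintype.prod_sum (fun n x => (p n x).toReal * g n x),
    Finset.prod_eq_single m (fun n _ hn => ?_) (by simp), hgm, expect]
  rw [hgn n hn]
  simp [sum_toReal_eq_one]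

end Product

namespace Bandit

variable {ι : Type*} {S A : ι → Type*} [Fintype ι] (M : Bandit S A)

/-- The sampled derivative of the objective: the factor of the learning rate in an update. -/
noncomputable def sampledSlope {K : ℕ} (as : Fin K → ∀ n, A n) : ℝ :=
  M.budget / (1 - M.discount) + ∑ n, M.sampledD as n

theorem sum_sampledD_cons {K : ℕ} (a : ∀ n, A n) (as : Fin K → ∀ n, A n) :
    ∑ n, M.sampledD (Fin.cons a as : Fin (K + 1) → ∀ n, A n) n =
      -∑ n, (M.arm n).cost (a n) + M.discount * ∑ n, M.sampledD as n := by
  rw [← Finset.sum_neg_distrib, Finset.mul_sum, ← Finset.sum_add_distrib]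
  refine Finset.sum_congr rfl fun n _ => ?_
  simp only [sampledD, Fin.sum_univ_succ, Fin.cons_zero, Fin.cons_succ, Fin.val_zero, pow_zero,
    one_mul, Fin.val_succ, pow_succ, mul_neg, Finset.mul_sum, neg_add]
  congr 2
  exact Finset.sum_congr rfl fun _ _ => by ring

theorem exists_abs_sampledSlope_le [∀ n, Fintype (A n)] :
    ∃ C : ℝ, 0 ≤ C ∧ ∀ (K : ℕ) (as : Fin K → ∀ n, A n), |M.sampledSlope as| ≤ C := by
  have hb : 0 < 1 - M.discount := by linarith [M.discount_lt_one]
  obtain ⟨c, hc⟩ := (Set.finite_range fun a : ∀ n, A n => |∑ n, (M.arm n).cost (a n)|).bddAbove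
  have hc' : ∀ a : ∀ n, A n, |∑ n, (M.arm n).cost (a n)| ≤ c := fun a => hc ⟨a, rfl⟩
  have hc0 : 0 ≤ c := (abs_nonneg _).trans (hc' fun n => (M.arm n).passive)
  have key : ∀ (K : ℕ) (as : Fin K → ∀ n, A n),
      |∑ n, M.sampledD as n| ≤ c / (1 - M.discount) := fun K => by
    induction K with
    | zero => intro as; simpa [sampledD] using div_nonneg hc0 hb.le
    | succ K ih =>
      intro as
      rw [← Fin.cons_self_tail as, sum_sampledD_cons]
      calc _ ≤ |-∑ n, (M.arm n).cost (as 0 n)| + |M.discount * ∑ n, M.sampledD (Fin.tail as) n| :=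
            abs_add_le _ _
        _ ≤ c + M.discount * (c / (1 - M.discount)) := by
            rw [abs_neg, abs_mul, abs_of_nonneg M.discount_nonneg]
            exact add_le_add (hc' _) (mul_le_mul_of_nonneg_left (ih _) M.discount_nonneg)
        _ = c / (1 - M.discount) := by field_simp; ring
  refine ⟨|M.budget / (1 - M.discount)| + c / (1 - M.discount),
    add_nonneg (abs_nonneg _) (div_nonneg hc0 hb.le), fun K as => ?_⟩
  exact (abs_add_le _ _).trans (add_le_add_right (key K as) _)

variable [∀ n, Fintype (S n)] [∀ n, Fintype (A n)]

open Classical in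
/-- The truncated rollout of an optimal policy at `lam` gives a supporting line of the value at
`lam` up to an error that decays like `β ^ K`: by induction on `K`, as the actions of the first
round are greedy at `lam` and remain available at the charge `y`. -/
theorem sum_value_add_expect_sampledD_le {π : Policies S A} (hπ : M.IsOptimal π) {C : ℝ}
    (hC : ∀ (s : ∀ n, S n) (x y : ℝ),
      |∑ n, M.value n x (s n) - ∑ n, M.value n y (s n)| ≤ C * |x - y|)
    (lam y : ℝ) (K : ℕ) (s : ∀ n, S n) :
    ∑ n, M.value n lam (s n) +
        (y - lam) * expect (M.rollout π lam K s) (fun as => ∑ n, M.sampledD as n) -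
        M.discount ^ K * (C * |lam - y|) ≤
      ∑ n, M.value n y (s n) := by
  induction K generalizing s with
  | zero =>
    have h := (abs_le.1 (hC s lam y)).2
    simp [rollout, expect_pure, sampledD]
    linarith
  | succ K ih =>
    simp only [rollout, expect_bind, expect_map, sum_sampledD_cons, expect_add, expect_const,
      expect_const_mul]
    set W : (∀ n, S n) → ℝ :=
      fun s' => expect (M.rollout π lam K s') fun as => ∑ n, M.sampledD as n with hW
    set q := indep fun n => π n lam (s n) with hq
    set T : (∀ n, A n) → PMF (∀ n, S n) :=
      fun a => indep fun n => (M.arm n).trans (s n) (a n) with hT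
    have step : ∀ a ∈ q.support,
        ∑ n, M.value n lam (s n) + (y - lam) *
          (-∑ n, (M.arm n).cost (a n) + M.discount * expect (T a) W) -
          M.discount ^ (K + 1) * (C * |lam - y|) ≤ ∑ n, M.value n y (s n) := fun a ha => by
      have hQ : ∀ n, M.value n lam (s n) = M.optimalQ n lam (s n) (a n) := fun n =>
        (M.optimalQ_eq_value (hπ n lam (s n) (a n)
          (mem_support_of_mem_support_indep ha n))).symm
      have hv : ∀ z, ∑ n, M.optimalQ n z (s n) (a n) = ∑ n, (M.arm n).reward (s n) -
          z * ∑ n, (M.arm n).cost (a n) +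
          M.discount * expect (T a) fun s' => ∑ n, M.value n z (s' n) := fun z => by
        rw [expect_sum, Finset.mul_sum, Finset.mul_sum, ← Finset.sum_sub_distrib,
          ← Finset.sum_add_distrib]
        refine Finset.sum_congr rfl fun n _ => ?_
        rw [optimalQ_eq_add_value, hT, expect_indep _ n (fun s' => M.value n z s'), expect]
      have h1 : ∑ n, M.optimalQ n y (s n) (a n) ≤ ∑ n, M.value n y (s n) :=
        Finset.sum_le_sum fun n _ => M.optimalQ_le_value n y (s n) (a n)
      have h2 := expect_mono (p := T a) ih
      simp only [sub_eq_add_neg (_ + _) (M.discount ^ K * _), expect_add, expect_const,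
        expect_const_mul] at h2
      have h3 := mul_le_mul_of_nonneg_left h2 M.discount_nonneg
      rw [Finset.sum_congr rfl fun n _ => hQ n, hv]
      rw [hv] at h1
      refine le_trans (le_of_eq ?_) (h1.trans' (add_le_add_right h3 _))
      ring
    have h := expect_mono_of_support step
    simp only [sub_eq_add_neg (_ + _) (M.discount ^ (K + 1) * _), expect_add, expect_const,
      expect_const_mul] at h
    rw [sub_eq_add_neg]
    exact h

end Bandit

end RMAB

/-! ### Drift of the squared distance to the optimal multipliers -/

namespace RMAB

theorem tsum_bind_mul {X Y : Type*} (p : PMF X) (q : X → PMF Y) (F : Y → ENNReal) :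
    ∑' y, (p.bind q) y * F y = ∑' x, p x * ∑' y, q x y * F y := by
  simp only [PMF.bind_apply, ← ENNReal.tsum_mul_right, ← ENNReal.tsum_mul_left]
  rw [ENNReal.tsum_comm]
  simp only [mul_assoc]

theorem tsum_map_mul {X Y : Type*} (p : PMF X) (g : X → Y) (F : Y → ENNReal) :
    ∑' y, (p.map g) y * F y = ∑' x, p x * F (g x) := by
  rw [PMF.map, tsum_bind_mul]
  refine tsum_congr fun x => ?_
  rw [tsum_eq_single (g x) fun y hy => by simp [PMF.pure_apply, hy]]
  simp

namespace Bandit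

variable {ι : Type*} {S A : ι → Type*} [Fintype ι] (M : Bandit S A)

theorem update_self {α : ℝ} {K : ℕ} (as : Fin K → ∀ n, A n) (s : ∀ n, S n)
    (l : (∀ n, S n) → ℝ) : M.update α as s l s = l s - α * M.sampledSlope as := by
  simp [update, sampledSlope]

theorem update_of_ne {α : ℝ} {K : ℕ} (as : Fin K → ∀ n, A n) {s s' : ∀ n, S n} (h : s' ≠ s)
    (l : (∀ n, S n) → ℝ) : M.update α as s l s' = l s' := by
  simp [update, h]

variable [∀ n, Fintype (S n)] [∀ n, Fintype (A n)]

open Classical in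
theorem tsum_epoch_mul [∀ n, Nonempty (S n)] (π : Policies S A) (α : ℝ) (K : ℕ)
    (l : (∀ n, S n) → ℝ) {F : ((∀ n, S n) → ℝ) → ℝ} (hF : ∀ x, 0 ≤ F x) :
    ∑' x, M.epoch π α K l x * ENNReal.ofReal (F x) =
      ENNReal.ofReal (expect (PMF.uniformOfFintype (∀ n, S n)) fun s =>
        expect (M.rollout π (l s) K s) fun as => F (M.update α as s l)) := by
  rw [epoch, tsum_bind_mul, ← tsum_mul_ofReal]
  · refine tsum_congr fun s => ?_
    rw [tsum_map_mul, tsum_mul_ofReal _ fun as => hF _]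
  · exact fun s => expect_nonneg fun as => hF _

variable (hB : ∃ a : ∀ n, A n, M.budget ≤ ∑ n, (M.arm n).cost (a n))
include hB

/-- A crude bound, valid for any policies and any number of rounds: it keeps `gap ^ 2` integrable in
the epochs before the number of rounds is large enough for the drift inequality. -/
theorem gap_sq_le {C : ℝ} (hC : ∀ (K : ℕ) (as : Fin K → ∀ n, A n), |M.sampledSlope as| ≤ C)
    (α : ℝ) {K : ℕ} (as : Fin K → ∀ n, A n) (s s' : ∀ n, S n) (l : (∀ n, S n) → ℝ) :
    M.gap s (M.update α as s' l s) ^ 2 ≤ 2 * M.gap s (l s) ^ 2 + 2 * (α ^ 2 * C ^ 2) := by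
  by_cases h : s = s'
  · subst h
    rw [update_self]
    obtain ⟨y, hy, hgap⟩ := M.exists_gap_eq hB s (l s)
    have h1 := pow_le_pow_left₀ (M.gap_nonneg s _)
      (M.gap_le_abs_sub hy (l s - α * M.sampledSlope as)) 2
    have h2 : M.sampledSlope as ^ 2 ≤ C ^ 2 := sq_le_sq' (abs_le.1 (hC K as)).1 (abs_le.1 (hC K as)).2
    rw [sq_abs] at h1
    rw [hgap, sq_abs]
    nlinarith [sq_nonneg (l s - y + α * M.sampledSlope as),
      mul_le_mul_of_nonneg_left h2 (sq_nonneg α)]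
  · rw [M.update_of_ne as h]
    nlinarith [sq_nonneg (M.gap s (l s)), mul_nonneg (sq_nonneg α) (sq_nonneg C)]

open Classical in
/-- A rollout started at `s` moves the multiplier towards the nearest optimal one `y`: its expected
slope is up to the truncation error, of size `β ^ K * D * gap`, a subgradient of the objective, and
the objective grows linearly with the gap. -/
theorem expect_rollout_gap_sq_le {C D δ : ℝ}
    (hC : ∀ (K : ℕ) (as : Fin K → ∀ n, A n), |M.sampledSlope as| ≤ C)
    (hD : ∀ (s : ∀ n, S n) (x y : ℝ),
      |∑ n, M.value n x (s n) - ∑ n, M.value n y (s n)| ≤ D * |x - y|)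
    (hδ : ∀ s, ∀ y ∈ M.optimalMultipliers s, ∀ lam,
      M.objective s y + δ * M.gap s lam ≤ M.objective s lam)
    {π : Policies S A} (hπ : M.IsOptimal π) {α : ℝ} (hα : 0 ≤ α) {K : ℕ}
    (hK : M.discount ^ K * D ≤ δ / 2) (s : ∀ n, S n) (lam : ℝ) :
    expect (M.rollout π lam K s) (fun as => M.gap s (lam - α * M.sampledSlope as) ^ 2) ≤
      M.gap s lam ^ 2 + α ^ 2 * C ^ 2 - α * δ * M.gap s lam := by
  obtain ⟨y, hy, hgap⟩ := M.exists_gap_eq hB s lam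
  have h1 : ∀ as : Fin K → ∀ n, A n, M.gap s (lam - α * M.sampledSlope as) ^ 2 ≤
      M.gap s lam ^ 2 + α ^ 2 * C ^ 2 - 2 * α * (lam - y) * (M.budget / (1 - M.discount)) +
        -(2 * α * (lam - y)) * ∑ n, M.sampledD as n := fun as => by
    have h2 := pow_le_pow_left₀ (M.gap_nonneg s _)
      (M.gap_le_abs_sub hy (lam - α * M.sampledSlope as)) 2
    have h3 : M.sampledSlope as ^ 2 ≤ C ^ 2 :=
      sq_le_sq' (abs_le.1 (hC K as)).1 (abs_le.1 (hC K as)).2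
    have h4 := mul_le_mul_of_nonneg_left h3 (sq_nonneg α)
    rw [sq_abs] at h2
    rw [hgap, sq_abs]
    calc _ ≤ (lam - α * M.sampledSlope as - y) ^ 2 := h2
      _ = (lam - y) ^ 2 + α ^ 2 * M.sampledSlope as ^ 2 -
          2 * α * (lam - y) * M.sampledSlope as := by ring
      _ ≤ (lam - y) ^ 2 + α ^ 2 * C ^ 2 - 2 * α * (lam - y) * M.sampledSlope as := by linarith
      _ = _ := by rw [sampledSlope]; ring
  refine (expect_mono h1).trans ?_
  rw [expect_add, expect_const, expect_const_mul]
  have h5 := M.sum_value_add_expect_sampledD_le hπ hD lam y K s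
  have h6 := hδ s y hy lam
  rw [objective_eq, objective_eq, hgap] at h6
  have h7 := mul_le_mul_of_nonneg_right hK (abs_nonneg (lam - y))
  rw [hgap]
  set W := expect (M.rollout π lam K s) fun as => ∑ n, M.sampledD as n
  have h8 : δ / 2 * |lam - y| ≤ (lam - y) * (M.budget / (1 - M.discount) + W) := by
    have : (lam - y) * (M.budget / (1 - M.discount)) =
      lam * M.budget / (1 - M.discount) - y * M.budget / (1 - M.discount) := by ring
    linarith
  linarith [mul_le_mul_of_nonneg_left h8 (mul_nonneg zero_le_two hα)]

/-- The drift of `gap ^ 2` in one epoch: a bound without conditions, and the decrease for optimal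
policies and sufficiently many rounds. The constant `κ` includes the probability with which an epoch
starts at `s`. -/
theorem exists_tsum_epoch_gap_sq_le [∀ n, Nonempty (S n)] :
    ∃ C κ : ℝ, ∃ K₀ : ℕ, 0 ≤ C ∧ 0 < κ ∧
      ∀ (π : Policies S A) (α : ℝ) (K : ℕ) (s : ∀ n, S n) (l : (∀ n, S n) → ℝ),
        ∑' x, M.epoch π α K l x * ENNReal.ofReal (M.gap s (x s) ^ 2) ≤
            ENNReal.ofReal (2 * M.gap s (l s) ^ 2 + 2 * (α ^ 2 * C)) ∧
        (M.IsOptimal π → 0 ≤ α → K₀ ≤ K →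
          ∑' x, M.epoch π α K l x * ENNReal.ofReal (M.gap s (x s) ^ 2) +
              ENNReal.ofReal (κ * (α * M.gap s (l s))) ≤
            ENNReal.ofReal (M.gap s (l s) ^ 2 + α ^ 2 * C)) := by
  classical
  obtain ⟨C, -, hC⟩ := M.exists_abs_sampledSlope_le
  obtain ⟨D, -, hD⟩ := M.exists_abs_sum_value_sub_le
  obtain ⟨δ, hδ0, hδ⟩ := M.exists_sharp_objective
  have hlim : Tendsto (fun K : ℕ => M.discount ^ K * D) atTop (𝓝 0) := by
    simpa using (tendsto_pow_atTop_nhds_zero_of_lt_one M.discount_nonneg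
      M.discount_lt_one).mul_const D
  obtain ⟨K₀, hK₀⟩ := eventually_atTop.1 (hlim.eventually_le_const (half_pos hδ0))
  set N : ℝ := (Fintype.card (∀ n, S n) : ℝ)⁻¹ with hN
  have hN0 : 0 < N := inv_pos.2 (Nat.cast_pos.2 Fintype.card_pos)
  refine ⟨C ^ 2, N * δ, K₀, sq_nonneg C, mul_pos hN0 hδ0, fun π α K s l => ⟨?_, ?_⟩⟩
  · rw [M.tsum_epoch_mul π α K l (F := fun x => M.gap s (x s) ^ 2) fun x => sq_nonneg _]
    refine ENNReal.ofReal_le_ofReal ?_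
    refine (expect_mono fun s' => expect_mono fun as => M.gap_sq_le hB hC α as s s' l).trans ?_
    simp only [expect_const, le_refl]
  · intro hπ hα hK
    rw [M.tsum_epoch_mul π α K l (F := fun x => M.gap s (x s) ^ 2) fun x => sq_nonneg _,
      ← ENNReal.ofReal_add (expect_nonneg fun s' => expect_nonneg fun as => sq_nonneg _)
        (mul_nonneg (mul_pos hN0 hδ0).le (mul_nonneg hα (M.gap_nonneg _ _)))]
    refine ENNReal.ofReal_le_ofReal ?_
    have h1 : ∀ s', expect (M.rollout π (l s') K s')
        (fun as => M.gap s (M.update α as s' l s) ^ 2) ≤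
        M.gap s (l s) ^ 2 + α ^ 2 * C ^ 2 +
          -(α * δ * M.gap s (l s)) * (if s' = s then 1 else 0) := fun s' => by
      by_cases h : s' = s
      · subst h
        simp only [update_self, if_true]
        have := M.expect_rollout_gap_sq_le hB hC hD hδ hπ hα (hK₀ K hK) s' (l s')
        linarith
      · simp only [M.update_of_ne _ (Ne.symm h), expect_const, if_neg h]
        nlinarith [mul_nonneg (sq_nonneg α) (sq_nonneg C)]
    have h2 : expect (PMF.uniformOfFintype (∀ n, S n)) (fun s' => if s' = s then 1 else 0) = N := by
      simp [expect, PMF.uniformOfFintype_apply, hN]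
    have h3 := expect_mono (p := PMF.uniformOfFintype (∀ n, S n)) h1
    rw [expect_add, expect_const, expect_const_mul, h2] at h3
    linarith

end Bandit

end RMAB

/-! ### Discrete Markov chains -/

namespace RMAB

section MarkovChain

variable {Ω X : Type*} [MeasurableSpace X]

/-- The event that the trajectory agrees with `l` up to time `t`. -/
def cylinder (L : ℕ → Ω → X) (t : ℕ) (l : ℕ → X) : Set Ω := {ω | ∀ i ≤ t, L i ω = l i}

variable [MeasurableSpace Ω] {L : ℕ → Ω → X}

/-- The σ-algebras generated by the trajectory up to each time. -/
def historyFiltration (hL : ∀ t, Measurable (L t)) : Filtration ℕ ‹MeasurableSpace Ω› where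
  seq t := MeasurableSpace.comap (fun ω (i : Set.Iic t) => L i ω) MeasurableSpace.pi
  mono' s t hst := by
    have h : (fun ω (i : Set.Iic s) => L i ω) =
        (fun (h : Set.Iic t → X) (i : Set.Iic s) => h ⟨i, i.2.trans hst⟩) ∘
          fun ω (i : Set.Iic t) => L i ω := rfl
    change MeasurableSpace.comap _ _ ≤ MeasurableSpace.comap _ _
    rw [h, ← MeasurableSpace.comap_comp]
    exact MeasurableSpace.comap_mono
      (measurable_pi_lambda _ fun i => measurable_pi_apply _).comap_le
  le' t := (measurable_pi_lambda (fun ω (i : Set.Iic t) => L i ω) fun i => hL i).comap_le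

theorem measurable_historyFiltration (hL : ∀ t, Measurable (L t)) (t : ℕ) :
    Measurable[historyFiltration hL t] (L t) := by
  have h : Measurable[MeasurableSpace.comap (fun ω (i : Set.Iic t) => L i ω) MeasurableSpace.pi]
      (fun ω (i : Set.Iic t) => L i ω) := comap_measurable _
  exact (measurable_pi_apply (⟨t, Set.self_mem_Iic⟩ : Set.Iic t)).comp h

variable [MeasurableSingletonClass X]

theorem ae_mem_support_and_lintegral_eq {ν : Measure X} {p : PMF X} {c : ENNReal} (hc : c ≠ ⊤)
    (huniv : ν Set.univ = c) (hν : ∀ x, ν {x} = c * p x) :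
    (∀ᵐ x ∂ν, x ∈ p.support) ∧ ∀ f : X → ENNReal, ∫⁻ x, f x ∂ν = c * ∑' x, p x * f x := by
  have hcount := p.support_countable
  have hsum : ∀ f : X → ENNReal, ∫⁻ x in p.support, f x ∂ν = c * ∑' x, p x * f x := fun f => by
    rw [lintegral_countable f hcount, ← ENNReal.tsum_mul_left,
      ← tsum_subtype_eq_of_support_subset (s := p.support)]
    · refine tsum_congr fun x => ?_
      rw [hν]; ring
    · intro x hx
      simp only [Function.mem_support, ne_eq, mul_eq_zero, not_or] at hx
      exact hx.2.1
  have hsupp : ν p.support = c := by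
    have := hsum fun _ => 1
    simpa [p.tsum_coe] using this
  have hae : ∀ᵐ x ∂ν, x ∈ p.support := by
    have hfin : IsFiniteMeasure ν := ⟨by rw [huniv]; exact hc.lt_top⟩
    have : ν p.supportᶜ = 0 := by
      rw [measure_compl hcount.measurableSet (measure_ne_top _ _), hsupp, huniv, tsub_self]
    exact this
  refine ⟨hae, fun f => ?_⟩
  rw [← hsum f, Measure.restrict_eq_self_of_ae_mem hae]

theorem measurableSet_cylinder (hL : ∀ t, Measurable (L t)) (t : ℕ) (l : ℕ → X) :
    MeasurableSet (cylinder L t l) := by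
  have : cylinder L t l = ⋂ i ≤ t, L i ⁻¹' {l i} := by ext; simp [cylinder]
  rw [this]
  exact MeasurableSet.iInter fun i => MeasurableSet.iInter fun _ =>
    hL i (measurableSet_singleton _)

variable {μ : Measure Ω} [IsProbabilityMeasure μ] {q : ℕ → X → PMF X} {x₀ : X}
  (hL : ∀ t, Measurable (L t))
  (htrans : ∀ (t : ℕ) (l : ℕ → X), μ (cylinder L (t + 1) l) =
    μ (cylinder L t l) * q t (l t) (l (t + 1)))

include hL htrans

theorem ae_mem_support_and_lintegral_cylinder (t : ℕ) (l : ℕ → X) :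
    (∀ᵐ ω ∂μ, ω ∈ cylinder L t l → L (t + 1) ω ∈ (q t (l t)).support) ∧
      ∀ f : X → ENNReal, Measurable f →
        ∫⁻ ω in cylinder L t l, f (L (t + 1) ω) ∂μ =
          μ (cylinder L t l) * ∑' x, q t (l t) x * f x := by
  have hcyl := measurableSet_cylinder hL t l
  obtain ⟨h1, h2⟩ := ae_mem_support_and_lintegral_eq
    (ν := (μ.restrict (cylinder L t l)).map (L (t + 1))) (p := q t (l t))
    (c := μ (cylinder L t l)) (measure_ne_top _ _)
    (by rw [Measure.map_apply (hL _) MeasurableSet.univ]; simp)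
    (fun x => by
      rw [Measure.map_apply (hL _) (measurableSet_singleton x),
        Measure.restrict_apply (hL _ (measurableSet_singleton x))]
      have h := htrans t (Function.update l (t + 1) x)
      have hc : cylinder L t (Function.update l (t + 1) x) = cylinder L t l := by
        ext ω
        refine forall₂_congr fun i hi => ?_
        rw [Function.update_of_ne (by omega)]
      have hc' : cylinder L (t + 1) (Function.update l (t + 1) x) =
          L (t + 1) ⁻¹' {x} ∩ cylinder L t l := by
        rw [← hc]
        ext ω
        simp only [cylinder, Set.mem_ofPred_eq, Set.mem_inter_iff, Set.mem_preimage,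
          Set.mem_singleton_iff]
        constructor
        · exact fun h => ⟨by simpa using h (t + 1) le_rfl, fun i hi => h i (by omega)⟩
        · rintro ⟨h, h'⟩ i hi
          rcases Nat.le_succ_iff.1 hi with hi | rfl
          exacts [h' i hi, by simpa using h]
      rw [hc, hc', Function.update_self, Function.update_of_ne (by omega)] at h
      exact h)
  refine ⟨?_, fun f hf => ?_⟩
  · rw [← ae_restrict_iff' hcyl]
    exact ae_of_ae_map (hL _).aemeasurable h1
  · rw [← h2 f, lintegral_map hf (hL _)]

variable (hinit : ∀ᵐ ω ∂μ, L 0 ω = x₀)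
include hinit

/-- A chain with countably supported transitions almost surely stays in the countable set of states
that are accessible from its start. -/
theorem exists_countable_ae_mem : ∃ C : Set X, C.Countable ∧ ∀ᵐ ω ∂μ, ∀ t, L t ω ∈ C := by
  -- the states accessible in `k` steps, by transitions of any time
  let C' : ℕ → Set X := fun k =>
    Nat.rec {x₀} (fun _ B => ⋃ x ∈ B, ⋃ t, (q t x).support) k
  have hcount : ∀ k, (C' k).Countable := fun k => by
    induction k with
    | zero => exact Set.countable_singleton x₀
    | succ k ih => exact ih.biUnion fun x _ => Set.countable_iUnion fun t => (q t x).support_countable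
  have hC : (⋃ k, C' k).Countable := Set.countable_iUnion hcount
  set C := ⋃ k, C' k with hCdef
  have hx₀ : x₀ ∈ C := Set.mem_iUnion.2 ⟨0, rfl⟩
  have hstep : ∀ x ∈ C, ∀ t, (q t x).support ⊆ C := fun x hx t y hy => by
    obtain ⟨k, hk⟩ := Set.mem_iUnion.1 hx
    exact Set.mem_iUnion.2 ⟨k + 1, Set.mem_biUnion hk (Set.mem_iUnion.2 ⟨t, hy⟩)⟩
  have : Countable C := hC
  refine ⟨C, hC, ?_⟩
  have key : ∀ t, ∀ᵐ ω ∂μ, ∀ i ≤ t, L i ω ∈ C := fun t => by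
    induction t with
    | zero =>
      filter_upwards [hinit] with ω hω i hi
      rw [Nat.le_zero.1 hi, hω]
      exact hx₀
    | succ t ih =>
      have hall := ae_all_iff.2 fun h : Fin (t + 1) → C =>
        (ae_mem_support_and_lintegral_cylinder hL htrans t
          fun i => if hi : i < t + 1 then h ⟨i, hi⟩ else x₀).1
      filter_upwards [ih, hall] with ω hω hω' i hi
      rcases Nat.le_succ_iff.1 hi with hi | rfl
      · exact hω i hi
      · have h := hω' (fun i => ⟨L i ω, hω i (by omega)⟩) fun i hi => by
          simp only [dif_pos (Nat.lt_succ_of_le hi)]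
        exact hstep _ (by simpa using hω t le_rfl) t h
  exact (ae_all_iff.2 key).mono fun ω hω t => hω t t le_rfl

/-- The Markov property in the form of a drift inequality: a bound on one-step expectations that
holds in each state integrates over every event of the past. -/
theorem setLIntegral_drift_le {t : ℕ} {f d φ : X → ENNReal} (hf : Measurable f)
    (hle : ∀ x, ∑' y, q t x y * f y + d x ≤ φ x) {E : Set Ω}
    (hE : MeasurableSet[historyFiltration hL t] E) :
    ∫⁻ ω in E, (f (L (t + 1) ω) + d (L t ω)) ∂μ ≤ ∫⁻ ω in E, φ (L t ω) ∂μ := by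
  obtain ⟨C, hC, hmem⟩ := exists_countable_ae_mem hL htrans hinit
  have : Countable C := hC
  have hE' := (historyFiltration hL).le t _ hE
  let ext : (Fin (t + 1) → C) → ℕ → X := fun h i => if hi : i < t + 1 then h ⟨i, hi⟩ else x₀
  let Z : (Fin (t + 1) → C) → Set Ω := fun h => E ∩ cylinder L t (ext h)
  have hZ : ∀ h, MeasurableSet (Z h) := fun h => hE'.inter (measurableSet_cylinder hL t _)
  have hdisj : Pairwise (Function.onFun Disjoint Z) := fun h h' hne => by
    refine Set.disjoint_left.2 fun ω hω hω' => hne ?_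
    funext i
    have h1 := hω.2 i (by omega)
    have h2 := hω'.2 i (by omega)
    simp only [ext, i.2, dif_pos] at h1 h2
    exact Subtype.ext (h1.symm.trans h2)
  have hae : E =ᵐ[μ] ⋃ h, Z h := by
    refine Filter.eventuallyEq_set.2 ?_
    filter_upwards [hmem] with ω hω
    refine ⟨fun hωE => Set.mem_iUnion.2 ⟨fun i => ⟨L i ω, hω i⟩, hωE, fun i hi => ?_⟩, fun h => ?_⟩
    · simp only [ext, dif_pos (Nat.lt_succ_of_le hi)]
    · obtain ⟨h, hω⟩ := Set.mem_iUnion.1 h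
      exact hω.1
  rw [setLIntegral_congr hae, setLIntegral_congr hae, lintegral_iUnion hZ hdisj,
    lintegral_iUnion hZ hdisj]
  refine ENNReal.tsum_le_tsum fun h => ?_
  -- an event of the past contains a cylinder or is disjoint from it
  obtain hempty | hfull : Z h = ∅ ∨ Z h = cylinder L t (ext h) := by
    obtain ⟨E', -, rfl⟩ := hE
    by_cases hne : (Z h).Nonempty
    · obtain ⟨ω₀, hω₀, hω₀'⟩ := hne
      refine Or.inr (Set.inter_eq_right.2 fun ω hω => ?_)
      have : (fun i : Set.Iic t => L i ω) = fun i : Set.Iic t => L i ω₀ :=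
        funext fun i => (hω i i.2).trans (hω₀' i i.2).symm
      rw [Set.mem_preimage, this]
      exact hω₀
    · exact Or.inl (Set.not_nonempty_iff_eq_empty.1 hne)
  · simp [hempty]
  · have hcyl := measurableSet_cylinder hL t (ext h)
    have hfm : Measurable fun ω => f (L (t + 1) ω) := hf.comp (hL (t + 1))
    have h1 : ∫⁻ ω in cylinder L t (ext h), (f (L (t + 1) ω) + d (L t ω)) ∂μ =
        ∫⁻ ω in cylinder L t (ext h), (f (L (t + 1) ω) + d (ext h t)) ∂μ :=
      setLIntegral_congr_fun hcyl fun ω hω => by simp only [hω t le_rfl]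
    have h2 : ∫⁻ ω in cylinder L t (ext h), φ (L t ω) ∂μ =
        ∫⁻ _ in cylinder L t (ext h), φ (ext h t) ∂μ :=
      setLIntegral_congr_fun hcyl fun ω hω => by simp only [hω t le_rfl]
    rw [hfull, h1, h2, lintegral_add_left hfm,
      (ae_mem_support_and_lintegral_cylinder hL htrans t (ext h)).2 f hf,
      setLIntegral_const, setLIntegral_const, mul_comm (d _), mul_comm (φ _), ← mul_add]
    exact mul_le_mul_right (hle _) _

end MarkovChain

/-! ### Almost supermartingales -/

/-- The Robbins–Siegmund theorem for a nonnegative process `V` with deterministic summable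
perturbations `a`: adding up the inequalities shows that `D` is summable, and `V t - ∑ k < t, a k`
is a supermartingale that is bounded in `L¹`. -/
theorem ae_tendsto_and_summable_of_drift {Ω : Type*} {m : MeasurableSpace Ω} {μ : Measure Ω}
    [IsFiniteMeasure μ] {ℱ : Filtration ℕ m} {V D : ℕ → Ω → ℝ} {a : ℕ → ℝ}
    (hV : StronglyAdapted ℱ V) (hV0 : ∀ t ω, 0 ≤ V t ω) (hD : ∀ t, Measurable (D t))
    (hD0 : ∀ t ω, 0 ≤ D t ω) (ha0 : ∀ t, 0 ≤ a t) (ha : Summable a)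
    (hint : ∫⁻ ω, ENNReal.ofReal (V 0 ω) ∂μ ≠ ⊤)
    (h : ∀ t E, MeasurableSet[ℱ t] E →
      ∫⁻ ω in E, (ENNReal.ofReal (V (t + 1) ω) + ENNReal.ofReal (D t ω)) ∂μ ≤
        ∫⁻ ω in E, ENNReal.ofReal (V t ω + a t) ∂μ) :
    ∀ᵐ ω ∂μ, (∃ c, Tendsto (fun t => V t ω) atTop (𝓝 c)) ∧ Summable fun t => D t ω := by
  have hVm : ∀ t, StronglyMeasurable (V t) := fun t => (hV t).mono (ℱ.le t)
  have hDm : ∀ t, Measurable fun ω => ENNReal.ofReal (D t ω) := fun t => (hD t).ennreal_ofReal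
  have hsum : ∀ t, ∫⁻ ω, ENNReal.ofReal (V t ω) ∂μ +
      ∑ k ∈ Finset.range t, ∫⁻ ω, ENNReal.ofReal (D k ω) ∂μ ≤
      ∫⁻ ω, ENNReal.ofReal (V 0 ω) ∂μ +
        ∑ k ∈ Finset.range t, ENNReal.ofReal (a k) * μ Set.univ := fun t => by
    induction t with
    | zero => simp
    | succ t ih =>
      have h1 := h t Set.univ MeasurableSet.univ
      simp only [Measure.restrict_univ, ENNReal.ofReal_add (hV0 t _) (ha0 t)] at h1
      rw [lintegral_add_right _ (hDm t), lintegral_add_right _ measurable_const,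
        lintegral_const] at h1
      rw [Finset.sum_range_succ, Finset.sum_range_succ]
      calc _ = (∫⁻ ω, ENNReal.ofReal (V (t + 1) ω) ∂μ + ∫⁻ ω, ENNReal.ofReal (D t ω) ∂μ) +
            ∑ k ∈ Finset.range t, ∫⁻ ω, ENNReal.ofReal (D k ω) ∂μ := by ring
        _ ≤ (∫⁻ ω, ENNReal.ofReal (V t ω) ∂μ + ENNReal.ofReal (a t) * μ Set.univ) +
            ∑ k ∈ Finset.range t, ∫⁻ ω, ENNReal.ofReal (D k ω) ∂μ := by gcongr
        _ = (∫⁻ ω, ENNReal.ofReal (V t ω) ∂μ +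
            ∑ k ∈ Finset.range t, ∫⁻ ω, ENNReal.ofReal (D k ω) ∂μ) +
            ENNReal.ofReal (a t) * μ Set.univ := by ring
        _ ≤ _ := by
          rw [← add_assoc]
          gcongr
  set B := ∫⁻ ω, ENNReal.ofReal (V 0 ω) ∂μ + (∑' k, ENNReal.ofReal (a k)) * μ Set.univ with hB
  have hBtop : B ≠ ⊤ := ENNReal.add_ne_top.2
    ⟨hint, ENNReal.mul_ne_top ha.tsum_ofReal_ne_top (measure_ne_top _ _)⟩
  have hsumB : ∀ t, ∫⁻ ω, ENNReal.ofReal (V t ω) ∂μ +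
      ∑ k ∈ Finset.range t, ∫⁻ ω, ENNReal.ofReal (D k ω) ∂μ ≤ B := fun t => by
    refine (hsum t).trans ?_
    rw [hB, ← Finset.sum_mul]
    gcongr
    exact ENNReal.sum_le_tsum _
  have hVB : ∀ t, ∫⁻ ω, ENNReal.ofReal (V t ω) ∂μ ≤ B := fun t => le_self_add.trans (hsumB t)
  have hsummable : ∀ᵐ ω ∂μ, Summable fun t => D t ω := by
    have h1 : ∫⁻ ω, ∑' k, ENNReal.ofReal (D k ω) ∂μ ≤ B := by
      rw [lintegral_tsum fun k => (hDm k).aemeasurable]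
      exact ENNReal.tsum_le_of_sum_range_le fun t => le_add_self.trans (hsumB t)
    filter_upwards [ae_lt_top (Measurable.tsum hDm) (ne_top_of_le_ne_top hBtop h1)]
      with ω hω
    simpa only [ENNReal.toReal_ofReal (hD0 _ ω)] using ENNReal.summable_toReal hω.ne
  have hVint : ∀ t, Integrable (V t) μ := fun t =>
    ⟨(hVm t).aestronglyMeasurable, by
      rw [hasFiniteIntegral_iff_ofReal (ae_of_all _ (hV0 t))]
      exact (hVB t).trans_lt hBtop.lt_top⟩
  have hsub : Submartingale (fun t ω => -V t ω + ∑ k ∈ Finset.range t, a k) ℱ μ := by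
    refine submartingale_of_setIntegral_le_succ
      (fun t => (hV t).neg.add stronglyMeasurable_const)
      (fun t => (hVint t).neg.add (integrable_const _)) fun t E hE => ?_
    have h1 : ∫ ω in E, V (t + 1) ω ∂μ ≤ ∫ ω in E, (V t ω + a t) ∂μ := by
      have hint' : Integrable (fun ω => V t ω + a t) (μ.restrict E) :=
        ((hVint t).add (integrable_const _)).integrableOn
      have hnn : ∀ ω, 0 ≤ V t ω + a t := fun ω => add_nonneg (hV0 t ω) (ha0 t)
      rw [← ENNReal.ofReal_le_ofReal_iff (integral_nonneg hnn),
        ofReal_integral_eq_lintegral_ofReal (hVint (t + 1)).integrableOn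
          (ae_of_all _ (hV0 (t + 1))),
        ofReal_integral_eq_lintegral_ofReal hint' (ae_of_all _ hnn)]
      exact (lintegral_mono fun ω => le_self_add).trans (h t E hE)
    have h2 : ∀ t, ∫ ω in E, (-V t ω + ∑ k ∈ Finset.range t, a k) ∂μ =
        -∫ ω in E, V t ω ∂μ + ∫ ω in E, (∑ k ∈ Finset.range t, a k) ∂μ := fun t => by
      rw [← integral_neg]
      exact integral_add (hVint t).integrableOn.neg (integrable_const _)
    rw [integral_add (hVint t).integrableOn (integrable_const _)] at h1
    rw [h2, h2, Finset.sum_range_succ, integral_add (integrable_const _) (integrable_const _)]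
    linarith
  have hbdd : ∀ t, eLpNorm (fun ω => -V t ω + ∑ k ∈ Finset.range t, a k) 1 μ ≤
      ((B + B).toNNReal : ENNReal) := fun t => by
    rw [ENNReal.coe_toNNReal (ENNReal.add_ne_top.2 ⟨hBtop, hBtop⟩), eLpNorm_one_eq_lintegral_enorm]
    have hs0 : 0 ≤ ∑ k ∈ Finset.range t, a k := Finset.sum_nonneg fun k _ => ha0 k
    have h1 : ∀ ω, ‖-V t ω + ∑ k ∈ Finset.range t, a k‖ₑ ≤
        ENNReal.ofReal (V t ω) + ENNReal.ofReal (∑ k ∈ Finset.range t, a k) := fun ω => by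
      refine (enorm_add_le _ _).trans ?_
      rw [enorm_neg, Real.enorm_eq_ofReal (hV0 t ω), Real.enorm_eq_ofReal hs0]
    refine (lintegral_mono h1).trans ?_
    rw [lintegral_add_right _ measurable_const, lintegral_const,
      ENNReal.ofReal_sum_of_nonneg fun k _ => ha0 k]
    refine add_le_add (hVB t) ?_
    rw [hB]
    refine le_add_left ?_
    gcongr
    exact ENNReal.sum_le_tsum _
  filter_upwards [hsub.exists_ae_tendsto_of_bdd hbdd, hsummable] with ω ⟨c, hc⟩ hω
  refine ⟨⟨(∑' k, a k) - c, ?_⟩, hω⟩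
  simpa using ha.hasSum.tendsto_sum_nat.sub hc

/-- If `∑ α t * g t` converges while `∑ α t` diverges, then a convergent `g ^ 2` tends to `0`. -/
theorem tendsto_zero_of_summable_mul {α g : ℕ → ℝ} (hα : ∀ t, 0 ≤ α t) (hα' : ¬ Summable α)
    (hg : ∀ t, 0 ≤ g t) (hsum : Summable fun t => α t * g t) {c : ℝ}
    (hc : Tendsto (fun t => g t ^ 2) atTop (𝓝 c)) : Tendsto g atTop (𝓝 0) := by
  have hg' : Tendsto g atTop (𝓝 (√c)) := by
    simpa [Real.sqrt_sq (hg _)] using hc.sqrt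
  rcases (Real.sqrt_nonneg c).eq_or_lt with h0 | h0
  · rwa [← h0] at hg'
  refine absurd ?_ hα'
  have hev : ∀ᶠ t in atTop, √c / 2 < g t := hg'.eventually_const_lt (half_lt_self h0)
  refine Summable.of_norm_bounded_eventually_nat (hsum.mul_left (2 / √c)) ?_
  filter_upwards [hev] with t ht
  rw [Real.norm_of_nonneg (hα t)]
  calc α t = 2 / √c * (α t * (√c / 2)) := by field_simp
    _ ≤ 2 / √c * (α t * g t) := by
      have := hα t
      gcongr

end RMAB

/-! ### Convergence of training runs -/

namespace RMAB.Bandit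

variable {ι : Type*} [Fintype ι] {S A : ι → Type*}
  [∀ n, Fintype (S n)] [∀ n, Fintype (A n)] (M : Bandit S A)

theorem tendsto_objective_of_tendsto_gap
    (hB : ∃ a : ∀ n, A n, M.budget ≤ ∑ n, (M.arm n).cost (a n)) {s : ∀ n, S n} {lam : ℕ → ℝ}
    (h : Tendsto (fun t => M.gap s (lam t)) atTop (𝓝 0)) :
    Tendsto (fun t => M.objective s (lam t)) atTop (𝓝 (⨅ lam, M.objective s lam)) := by
  obtain ⟨C, hC⟩ := M.exists_abs_objective_sub_iInf_le hB s
  rw [tendsto_iff_norm_sub_tendsto_zero]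
  refine squeeze_zero (fun t => norm_nonneg _) (fun t => hC (lam t)) ?_
  simpa using h.const_mul C

/-- Finitely many samples per epoch suffice for the convergence to the optimal multipliers itself,
since the minimum of the objective is sharp and dominates a small truncation error. -/
theorem exists_ae_tendsto_gap [∀ n, Nonempty (S n)]
    (hB : ∃ a : ∀ n, A n, M.budget ≤ ∑ n, (M.arm n).cost (a n))
    {π : ℕ → Policies S A} (hπ : ∀ t, M.IsOptimal (π t))
    {α : ℕ → ℝ} (hα : ∀ t, 0 ≤ α t)
    (hα_sum : Tendsto (fun T => ∑ t ∈ Finset.range T, α t) atTop atTop)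
    (hα_sq : Summable fun t => α t ^ 2)
    (L₀ : (∀ n, S n) → ℝ) :
    ∃ K₀ : ℕ, ∀ K : ℕ → ℕ, (∀ᶠ t in atTop, K₀ ≤ K t) →
      ∀ {Ω : Type*} [MeasurableSpace Ω] (μ : Measure Ω) [IsProbabilityMeasure μ]
        (L : ℕ → Ω → (∀ n, S n) → ℝ), M.IsTrainingRun π α K L₀ μ L →
        ∀ᵐ ω ∂μ, ∀ s, Tendsto (fun t => M.gap s (L t ω s)) atTop (𝓝 0) := by
  obtain ⟨C, κ, K₀, hC, hκ, hdrift⟩ := M.exists_tsum_epoch_gap_sq_le hB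
  refine ⟨K₀, fun K hK Ω _ μ _ L hrun => ?_⟩
  obtain ⟨t₀, ht₀⟩ := eventually_atTop.1 hK
  have hα' : ¬ Summable fun j => α (t₀ + j) := fun h => by
    have h' : Summable α := by
      rw [← summable_nat_add_iff t₀]
      simpa only [add_comm] using h
    exact not_tendsto_nhds_of_tendsto_atTop hα_sum _ h'.hasSum.tendsto_sum_nat
  rw [ae_all_iff]
  intro s
  have hmeas : Measurable fun l : (∀ n, S n) → ℝ => M.gap s (l s) :=
    (M.continuous_gap s).measurable.comp (measurable_pi_apply s)
  have hmeas' : Measurable fun l : (∀ n, S n) → ℝ => ENNReal.ofReal (M.gap s (l s) ^ 2) :=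
    (hmeas.pow_const 2).ennreal_ofReal
  have hfin : ∀ t, ∫⁻ ω, ENNReal.ofReal (M.gap s (L t ω s) ^ 2) ∂μ ≠ ⊤ := fun t => by
    induction t with
    | zero =>
      rw [lintegral_congr_ae (g := fun _ => ENNReal.ofReal (M.gap s (L₀ s) ^ 2))
        (hrun.initial.mono fun ω hω => by simp only [hω])]
      simp
    | succ t ih =>
      have h := setLIntegral_drift_le (q := fun t => M.epoch (π t) (α t) (K t))
        hrun.measurable hrun.transition hrun.initial (t := t) (d := fun _ => 0) hmeas'
        (fun l => by simpa using (hdrift (π t) (α t) (K t) s l).1) MeasurableSet.univ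
      simp only [Measure.restrict_univ, add_zero] at h
      refine ne_top_of_le_ne_top ?_ h
      have h2 : ∀ ω, ENNReal.ofReal (2 * M.gap s (L t ω s) ^ 2 + 2 * (α t ^ 2 * C)) ≤
          2 * ENNReal.ofReal (M.gap s (L t ω s) ^ 2) + ENNReal.ofReal (2 * (α t ^ 2 * C)) :=
        fun ω => ENNReal.ofReal_add_le.trans_eq (by
          rw [ENNReal.ofReal_mul zero_le_two, ENNReal.ofReal_ofNat])
      refine ne_top_of_le_ne_top ?_ (lintegral_mono h2)
      rw [lintegral_add_right _ measurable_const, lintegral_const,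
        lintegral_const_mul' _ _ ENNReal.ofNat_ne_top]
      exact ENNReal.add_ne_top.2 ⟨ENNReal.mul_ne_top ENNReal.ofNat_ne_top ih,
        ENNReal.mul_ne_top ENNReal.ofReal_ne_top (measure_ne_top _ _)⟩
  -- the drift inequality is available from the epoch `t₀` on
  let ℱ := historyFiltration hrun.measurable
  let 𝒢 : Filtration ℕ ‹MeasurableSpace Ω› :=
    { seq := fun j => ℱ (t₀ + j)
      mono' := fun i j hij => ℱ.mono (by omega)
      le' := fun j => ℱ.le _ }
  have hconv := ae_tendsto_and_summable_of_drift (ℱ := 𝒢) (μ := μ)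
    (V := fun j ω => M.gap s (L (t₀ + j) ω s) ^ 2)
    (D := fun j ω => κ * (α (t₀ + j) * M.gap s (L (t₀ + j) ω s)))
    (a := fun j => α (t₀ + j) ^ 2 * C)
    (fun j => ((hmeas.pow_const 2).comp
      (measurable_historyFiltration hrun.measurable (t₀ + j))).stronglyMeasurable)
    (fun j ω => sq_nonneg _)
    (fun j => ((hmeas.comp (hrun.measurable (t₀ + j))).const_mul _).const_mul _)
    (fun j ω => mul_nonneg hκ.le (mul_nonneg (hα _) (M.gap_nonneg _ _)))
    (fun j => mul_nonneg (sq_nonneg _) hC)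
    (by
      refine Summable.mul_right C ?_
      have h := (summable_nat_add_iff t₀).2 hα_sq
      simpa only [add_comm] using h)
    (hfin _)
    (fun j E hE => setLIntegral_drift_le (q := fun t => M.epoch (π t) (α t) (K t))
        hrun.measurable hrun.transition hrun.initial (t := t₀ + j)
        (d := fun l => ENNReal.ofReal (κ * (α (t₀ + j) * M.gap s (l s))))
        (φ := fun l => ENNReal.ofReal (M.gap s (l s) ^ 2 + α (t₀ + j) ^ 2 * C)) hmeas'
        (fun l => (hdrift (π (t₀ + j)) (α (t₀ + j)) (K (t₀ + j)) s l).2 (hπ _) (hα _)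
          (ht₀ _ (by omega))) hE)
  filter_upwards [hconv] with ω ⟨⟨c, hc⟩, hsum⟩
  have h := tendsto_zero_of_summable_mul (fun j => hα (t₀ + j)) hα'
    (fun j => M.gap_nonneg s (L (t₀ + j) ω s)) ((summable_mul_left_iff hκ.ne').1 hsum) hc
  rw [← tendsto_add_atTop_iff_nat t₀]
  simpa only [add_comm] using h

end RMAB.Bandit

theorem proposition2 {ι : Type*} [Fintype ι] {S A : ι → Type*}
    [∀ n, Fintype (S n)] [∀ n, Nonempty (S n)] [∀ n, Fintype (A n)]
    (M : RMAB.Bandit S A)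
    (hB : ∃ a : ∀ n, A n, M.budget ≤ ∑ n, (M.arm n).cost (a n))
    (π : ℕ → RMAB.Bandit.Policies S A) (hπ : ∀ t, M.IsOptimal (π t))
    (α : ℕ → ℝ) (hα : ∀ t, 0 ≤ α t)
    (hα_sum : Tendsto (fun T => ∑ t ∈ Finset.range T, α t) atTop atTop)
    (hα_sq : Summable fun t => α t ^ 2)
    (L₀ : (∀ n, S n) → ℝ) :
    (∀ s, (M.optimalMultipliers s).Nonempty) ∧
    (∀ K : ℕ → ℕ, Tendsto K atTop atTop →
      ∀ (Ω : Type*) [MeasurableSpace Ω] (μ : Measure Ω) [IsProbabilityMeasure μ]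
        (L : ℕ → Ω → (∀ n, S n) → ℝ), M.IsTrainingRun π α K L₀ μ L →
        ∀ᵐ ω ∂μ, ∀ s,
          Tendsto (fun t => Metric.infDist (L t ω s) (M.optimalMultipliers s)) atTop (𝓝 0) ∧
          Tendsto (fun t => M.objective s (L t ω s)) atTop (𝓝 (⨅ lam, M.objective s lam))) ∧
    (∀ ε : ℝ, 0 < ε → ∃ K₀ : ℕ, ∀ K ≥ K₀,
      ∀ (Ω : Type*) [MeasurableSpace Ω] (μ : Measure Ω) [IsProbabilityMeasure μ]
        (L : ℕ → Ω → (∀ n, S n) → ℝ), M.IsTrainingRun π α (fun _ => K) L₀ μ L →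
        ∀ᵐ ω ∂μ, ∀ s, ∀ᶠ t in atTop,
          Metric.infDist (L t ω s) (M.optimalMultipliers s) < ε ∧
          M.objective s (L t ω s) < (⨅ lam, M.objective s lam) + ε) := by
  refine ⟨M.optimalMultipliers_nonempty hB, fun K hK Ω _ μ _ L hrun => ?_, fun ε hε => ?_⟩
  · obtain ⟨K₀, hconv⟩ := M.exists_ae_tendsto_gap hB hπ hα hα_sum hα_sq L₀
    filter_upwards [hconv K (hK.eventually_ge_atTop K₀) μ L hrun] with ω hω s
    exact ⟨hω s, M.tendsto_objective_of_tendsto_gap hB (hω s)⟩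
  · obtain ⟨K₀, hconv⟩ := M.exists_ae_tendsto_gap hB hπ hα hα_sum hα_sq L₀
    refine ⟨K₀, fun K hK Ω _ μ _ L hrun => ?_⟩
    filter_upwards [hconv (fun _ => K) (Eventually.of_forall fun _ => hK) μ L hrun] with ω hω s
    exact ((hω s).eventually_lt_const hε).and
      ((M.tendsto_objective_of_tendsto_gap hB (hω s)).eventually_lt_const (by linarith))
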